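/- All logarithms are binary. Fix the standard enumeration $T_0,T_1,\dots$ of the partial recursive functions and the reference universal machine $U$ that, on the binary program $1^i0p$ and side information $y$, returns $T_i(\langle p,y\rangle)$. Let $C(x\mid y)$ be the length of a shortest binary program from which $U$, given $y$, computes $x$. A labeled graph $G$ on the nodes $\{1,\dots,n\}$ is identified with the string $E(G)\in\{0,1\}^{n(n-1)/2}$ that lists, in lexicographical order of the pairs $u<v$, which edges are present. For a real $\delta(n)\ge 0$, $G$ is called $\delta(n)$-random if $C(E(G)\mid n,\lfloor\delta(n)\rfloor)\ge n(n-1)/2-\delta(n)$. A routing scheme for $G$ gives every node $u$ a local routing function, which maps each destination $w\ne u$ to a neighbour of $u$, the next node on the route to $w$. It has stretch factor at most $s$ if, for all $u\neq w$, following the local routing functions from $u$ leads to $w$ in at most $s\cdot d_G(u,w)$ steps. Nodes keep their labels and know their own label and the labels of their neighbours for free: a binary string $p$ stores the local routing function of $u$ if, for every destination $w\ne u$, $U$ on program $p$ computes the label of the next node from the label of $u$, the increasing list of the labels of the neighbours of $u$, and the label of $w$. The number of bits used at $u$ is the length of $p$. **Theorem.** Let $c\ge 0$ be a constant. There are constants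 $C$ and $N$, depending only on $c$, such that every $c\log n$-random labeled graph $G$ on $n\ge N$ nodes has a routing scheme of stretch factor at most $2$ whose local routing functions are stored in at most $\log\log n+C$ bits at each of $n-1$ nodes and in at most $3n$ bits at the one remaining node, and the complete routing scheme is stored in at most $n\log\log n+3n$ bits in total. -/

import Mathlib

namespace CompactRouting

/-! ### Kolmogorov complexity -/

/-- The reference universal machine. The program `1^i 0 p` (a binary string) with side
information `y` runs the `i`-th partial recursive function in the standard enumeration
on the pair `⟨p, y⟩`. A string without the separator `0` computes nothing. -/
def universal : List Bool → ℕ → Part ℕ :=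
  fun prog y =>
    match prog.dropWhile (fun b => b) with
    | [] => Part.none
    | _ :: p =>
      (Denumerable.ofNat Nat.Partrec.Code (prog.takeWhile (fun b => b)).length).eval
        (Encodable.encode (p, y))

/-- `prog` is a program that computes `x` from `y` on the reference machine. -/
def Computes {α β : Type} [Primcodable α] [Primcodable β]
    (prog : List Bool) (y : β) (x : α) : Prop :=
  Encodable.encode x ∈ universal prog (Encodable.encode y)

/-- Every object is computed by some program, so that the minimum below is attained. -/
theorem exists_computes {α β : Type} [Primcodable α] [Primcodable β] (x : α) (y : β) :
    ∃ prog : List Bool, Computes prog y x := by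
  refine ⟨List.replicate
    (Encodable.encode (Nat.Partrec.Code.const (Encodable.encode x))) true ++ [false], ?_⟩
  simp [Computes, universal]

/-- The Kolmogorov complexity `C(x | y)`: the length of a shortest program that
computes `x` from `y`. -/
noncomputable def complexity {α β : Type} [Primcodable α] [Primcodable β] (x : α) (y : β) : ℕ :=
  sInf {k | ∃ prog : List Bool, prog.length = k ∧ Computes prog y x}

/-! ### Labeled graphs and random graphs -/

/-- The possible edges `(u, v)` with `u < v`, in lexicographical order. -/
def edgeSlots (n : ℕ) : List (Fin n × Fin n) :=
  (List.product (List.finRange n) (List.finRange n)).filter (fun e => e.1 < e.2)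

open Classical in
/-- The binary string `E(G)`: the `i`-th bit says whether the `i`-th possible edge
is present. -/
noncomputable def graphCode {n : ℕ} (G : SimpleGraph (Fin n)) : List Bool :=
  (edgeSlots n).map (fun e => decide (G.Adj e.1 e.2))

/-- `G` is `δ(n)`-random among all labeled graphs on `n` nodes:
`C(E(G) | n, δ(n)) ≥ n(n-1)/2 - δ(n)`. The deficiency is rounded down to a natural
number when it is given to the machine as side information. -/
def IsRandomGraph (δ : ℕ → ℝ) {n : ℕ} (G : SimpleGraph (Fin n)) : Prop :=
  (n : ℝ) * ((n : ℝ) - 1) / 2 - δ n ≤ (complexity (graphCode G) (n, ⌊δ n⌋₊) : ℝ)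

/-! ### Routing -/

/-- The label of a node; the labels are `1, …, n`. -/
def label {n : ℕ} (v : Fin n) : ℕ := (v : ℕ) + 1

open Classical in
/-- The labels of the neighbours of `v`, in increasing order. -/
noncomputable def neighbourLabels {n : ℕ} (G : SimpleGraph (Fin n)) (v : Fin n) : List ℕ :=
  ((List.finRange n).filter (fun w => decide (G.Adj v w))).map label

/-- A routing scheme gives each node `u` its local routing function `F u`, which sends a
destination `w ≠ u` to the neighbour of `u` across the edge over which a message for `w`
leaves `u`. -/
structure RoutingScheme {n : ℕ} (G : SimpleGraph (Fin n)) where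
  next : Fin n → Fin n → Fin n
  adj_next : ∀ u w, u ≠ w → G.Adj u (next u w)

/-- `F.Route w u k`: a message for `w` that is at `u` reaches `w` after exactly `k` hops. -/
inductive RoutingScheme.Route {n : ℕ} {G : SimpleGraph (Fin n)} (F : RoutingScheme G)
    (w : Fin n) : Fin n → ℕ → Prop
  | arrived : RoutingScheme.Route F w w 0
  | hop {u : Fin n} {k : ℕ} (h : u ≠ w) (hr : RoutingScheme.Route F w (F.next u w) k) :
      RoutingScheme.Route F w u (k + 1)

/-- The scheme delivers every message, over a route at most `s` times as long as a shortest
path. (If `w` could not be reached from `u ≠ w`, then `G.dist u w = 0` and the inequality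
would fail.) -/
def RoutingScheme.StretchAtMost {n : ℕ} {G : SimpleGraph (Fin n)} (F : RoutingScheme G)
    (s : ℝ) : Prop :=
  ∀ u w, u ≠ w → ∃ k : ℕ, F.Route w u k ∧ (k : ℝ) ≤ s * (G.dist u w : ℝ)

/-- The binary string `prog` stores the local routing function of `v` when nodes know their
neighbours: from the label of `v` and the labels of its neighbours, which are free, and the
label of a destination `w ≠ v`, the reference machine run on `prog` computes the label of the
neighbour to which a message for `w` is sent. -/
def RoutingScheme.StoredBy {n : ℕ} {G : SimpleGraph (Fin n)} (F : RoutingScheme G)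
    (v : Fin n) (prog : List Bool) : Prop :=
  ∀ w, w ≠ v → Computes prog (label v, neighbourLabels G v, label w) (label (F.next v w))

end CompactRouting

namespace CompactRouting

open Encodable

/-! ### Primitive recursive list functions -/

/-! Node `0` (labelled 1) serves as a hub. A message for a neighbour is delivered directly. For a
non-neighbour, a node other than the hub forwards towards the hub: to the hub itself if adjacent,
otherwise to a common neighbour with it. The hub forwards to its first neighbour that is adjacent to
the destination. A non-adjacent pair is at distance at least 2 and is served in at most 4 hops
(`exists_routingScheme`, `stretchAtMost_two`).

Storage rests on three properties of the graph. Every other node has a common neighbour with the hub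
among the first `O(log n)` nodes, and its position in the neighbour list is no larger than its
number, so `log log n + O(1)` bits name it. The hub writes its positions in unary; given the hub's
edges, the block lengths for non-neighbours are independent truncated geometric variables of mean at
most 2, so `3 n` bits suffice with room for the program prefix. Finally, fewer than `3 n / 4` nodes
are not adjacent to the hub. Neighbours of the hub need only a constant number of bits, and the `(n
/ 4) log log n` bits saved there absorb all constants in the total.

Each property is a primitive recursive test failed by a uniform graph with probability at most `2 ^
(-a * size n)`, where `a ≥ c + 1`. Exponential moments give this for degree and table
(`expect_lowDegree_le`, `expect_longTable_le`), a union bound for links (`expect_missingLink_le`).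
The failing codes can be listed, so a failing graph is described by its position among them, which
is too short for a `c log n`-random graph (`exists_forall_random_pass`). -/

theorem primrec_filter {α β : Type} [Primcodable α] [Primcodable β] {f : α → List β}
    {p : α → β → Bool} (hf : Primrec f) (hp : Primrec₂ p) :
    Primrec fun a => (f a).filter (p a) := by
  refine (Primrec.listFilterMap (g := fun a b => bif p a b then some b else none) hf
    (Primrec.cond hp (Primrec.option_some.comp Primrec.snd) (Primrec.const none))).of_eq fun a => ?_
  rw [← List.filterMap_eq_filter]
  congr 1
  funext b
  cases h : p a b <;> simp [Option.guard, h]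

theorem primrec_all {α β : Type} [Primcodable α] [Primcodable β] {f : α → List β}
    {p : α → β → Bool} (hf : Primrec f) (hp : Primrec₂ p) :
    Primrec fun a => (f a).all (p a) := by
  refine (Primrec.list_foldr (h := fun a s => p a s.1 && s.2) hf (Primrec.const true)
    (Primrec.and.comp₂ (hp.comp Primrec.fst (Primrec.fst.comp Primrec.snd)).to₂
      (Primrec.snd.comp Primrec.snd).to₂)).of_eq fun a => ?_
  dsimp only
  induction f a <;> simp [*]

theorem primrec_any {α β : Type} [Primcodable α] [Primcodable β] {f : α → List β}
    {p : α → β → Bool} (hf : Primrec f) (hp : Primrec₂ p) :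
    Primrec fun a => (f a).any (p a) :=
  (Primrec.not.comp (primrec_all hf (Primrec.not.comp₂ hp))).of_eq fun a => by
    simp [List.all_eq_not_any_not]

theorem primrec_sum_map {α β : Type} [Primcodable α] [Primcodable β] {f : α → List β}
    {g : α → β → ℕ} (hf : Primrec f) (hg : Primrec₂ g) :
    Primrec fun a => ((f a).map (g a)).sum := by
  refine (Primrec.list_foldr (h := fun a s => g a s.1 + s.2) hf (Primrec.const 0)
    (Primrec.nat_add.comp₂ (hg.comp Primrec.fst (Primrec.fst.comp Primrec.snd)).to₂
      (Primrec.snd.comp Primrec.snd).to₂)).of_eq fun a => ?_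
  dsimp only
  induction f a <;> simp [*]

/-! ### Binary strings of a given length -/

/-- All binary strings of length `k`. -/
def bitStrings : ℕ → List (List Bool)
  | 0 => [[]]
  | k + 1 => (bitStrings k).flatMap fun l => [true :: l, false :: l]

theorem mem_bitStrings {k : ℕ} {l : List Bool} : l ∈ bitStrings k ↔ l.length = k := by
  induction k generalizing l with
  | zero => simp [bitStrings]
  | succ k ih =>
    rcases l with _ | ⟨b, l⟩
    · simp [bitStrings]
    · cases b <;> simp [bitStrings, ih]

theorem length_bitStrings (k : ℕ) : (bitStrings k).length = 2 ^ k := by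
  induction k with
  | zero => rfl
  | succ k ih => simp [bitStrings, List.length_flatMap, ih, pow_succ]

theorem nodup_bitStrings (k : ℕ) : (bitStrings k).Nodup := by
  induction k with
  | zero => simp [bitStrings]
  | succ k ih =>
    rw [bitStrings, List.nodup_flatMap]
    refine ⟨fun l _ => by simp, ih.imp fun {a b} hab => ?_⟩
    simp [Function.onFun, Ne.symm hab]

theorem primrec_bitStrings : Primrec bitStrings := by
  have h : Primrec fun z : ℕ × List (List Bool) =>
      z.2.flatMap fun l => [true :: l, false :: l] :=
    Primrec.list_flatMap Primrec.snd
      (Primrec.list_cons.comp (Primrec.list_cons.comp (Primrec.const true) Primrec.snd)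
        (Primrec.list_cons.comp (Primrec.list_cons.comp (Primrec.const false) Primrec.snd)
          (Primrec.const []))).to₂
  refine (Primrec.nat_rec₁ [[]] h.to₂).of_eq fun k => ?_
  induction k with
  | zero => rfl
  | succ k ih => simp only [bitStrings, ← ih]

/-- The position of a binary string among all strings of its length. -/
def bitIndex (p : List Bool) : ℕ := (bitStrings p.length).idxOf p

theorem primrec_bitIndex : Primrec bitIndex :=
  (Primrec.list_idxOf.comp Primrec.id (primrec_bitStrings.comp Primrec.list_length)).of_eq
    fun p => by unfold bitIndex; congr 1; exact lawful_beq_subsingleton _ _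

/-- The machine sees where a program ends, so `k` bits name `2 ^ k` objects without any delimiter.
For `k = 0` the empty string names the index `0`. -/
theorem exists_bitIndex_eq {k j : ℕ} (h : j < 2 ^ k) :
    ∃ p : List Bool, p.length = k ∧ bitIndex p = j := by
  rw [← length_bitStrings] at h
  have hl : ((bitStrings k)[j]).length = k := mem_bitStrings.1 (List.getElem_mem h)
  refine ⟨(bitStrings k)[j], hl, ?_⟩
  rw [bitIndex, hl]
  exact (nodup_bitStrings k).idxOf_getElem j h

/-! ### Programs for the universal machine -/

/-- The program `1^i 0 p`. -/
def program (i : ℕ) (p : List Bool) : List Bool := List.replicate i true ++ false :: p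

@[simp] theorem length_program (i : ℕ) (p : List Bool) :
    (program i p).length = i + 1 + p.length := by
  simp [program]; omega

theorem exists_program_computes {α β : Type} [Primcodable α] [Primcodable β]
    {f : List Bool × β → α} (hf : Computable f) :
    ∃ i, ∀ p y, Computes (program i p) y (f (p, y)) := by
  obtain ⟨c, hc⟩ := Nat.Partrec.Code.exists_code.1 hf
  refine ⟨encode c, fun p y => ?_⟩
  have h1 : (program (encode c) p).dropWhile (fun b => b) = false :: p := by
    simp [program]
  have h2 : ((program (encode c) p).takeWhile (fun b => b)).length = encode c := by
    simp [program]
  unfold Computes universal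
  simp only [h1, h2, Denumerable.ofNat_encode, hc]
  simp [encode_prod_val]

theorem complexity_le {α β : Type} [Primcodable α] [Primcodable β] {x : α} {y : β}
    {p : List Bool} (h : Computes p y x) : complexity x y ≤ p.length :=
  Nat.sInf_le ⟨p, rfl, h⟩

/-- A string that belongs to a small primitive recursive family has small complexity. -/
theorem exists_complexity_le_of_test {len : ℕ → ℕ} (hlen : Primrec len)
    {T : ℕ → List Bool → Bool} (hT : Primrec₂ T) :
    ∃ i, ∀ n d k x, x.length = len n → T n x = true →
      ((bitStrings (len n)).filter (T n)).length ≤ 2 ^ k →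
      complexity x ((n, d) : ℕ × ℕ) ≤ i + k := by
  -- The decoder lists the strings that pass the test and returns the one at position `bitIndex` of
  -- its input; it ignores the side information `d`.
  let f : List Bool × (ℕ × ℕ) → List Bool := fun z =>
    ((bitStrings (len z.2.1)).filter (T z.2.1)).getD (bitIndex z.1) []
  have hf : Primrec f := by
    have hn : Primrec fun z : List Bool × (ℕ × ℕ) => z.2.1 := Primrec.fst.comp Primrec.snd
    exact (Primrec.list_getD []).comp
      (primrec_filter (primrec_bitStrings.comp (hlen.comp hn))
        (hT.comp₂ (hn.comp Primrec.fst).to₂ Primrec.snd.to₂))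
      (primrec_bitIndex.comp Primrec.fst)
  obtain ⟨i, hi⟩ := exists_program_computes hf.to_comp
  refine ⟨i + 1, fun n d k x hx hTx hk => ?_⟩
  have hmem : x ∈ (bitStrings (len n)).filter (T n) :=
    List.mem_filter.2 ⟨mem_bitStrings.2 hx, hTx⟩
  obtain ⟨j, hj, rfl⟩ := List.getElem_of_mem hmem
  obtain ⟨p, hp, hpj⟩ := exists_bitIndex_eq (hj.trans_le hk)
  have := hi p (n, d)
  have e : f (p, (n, d)) = ((bitStrings (len n)).filter (T n))[j] := by
    simp only [f, hpj]
    exact List.getD_eq_getElem _ _ hj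
  rw [e] at this
  simpa [hp] using complexity_le this

end CompactRouting

namespace CompactRouting

open Finset
open scoped BigOperators

/-! ### Averages over uniformly random bits -/

theorem dependsOn_apply_bit {ι β : Type*} (i : ι) (f : Bool → β) :
    DependsOn (fun ω : ι → Bool => f (ω i)) {i} := fun x y h => by simp [h i rfl]

section Average

variable {ι : Type*} [Fintype ι] [DecidableEq ι]

/-- Resampling the bits outside `s` does not change an average. -/
theorem expect_mix (s : Set ι) [DecidablePred (· ∈ s)] (F : (ι → Bool) → ℝ) :
    𝔼 ω, F ω = 𝔼 ω', 𝔼 ω, F (s.piecewise ω' ω) := by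
  rw [← Finset.expect_product' univ univ fun ω' ω => F (s.piecewise ω' ω)]
  -- Exchanging the coordinates outside `s` between two samples is an involution on pairs of
  -- samples.
  let σ : (ι → Bool) × (ι → Bool) ≃ (ι → Bool) × (ι → Bool) :=
    { toFun := fun z => (s.piecewise z.1 z.2, s.piecewise z.2 z.1)
      invFun := fun z => (s.piecewise z.1 z.2, s.piecewise z.2 z.1)
      left_inv := fun z => by
        ext i <;> by_cases h : i ∈ s <;> simp [h]
      right_inv := fun z => by
        ext i <;> by_cases h : i ∈ s <;> simp [h] }
  have h : 𝔼 z : (ι → Bool) × (ι → Bool), F (s.piecewise z.1 z.2)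
      = 𝔼 z : (ι → Bool) × (ι → Bool), F z.1 :=
    Fintype.expect_equiv σ _ _ fun z => rfl
  rw [Finset.univ_product_univ, h, ← Finset.univ_product_univ,
    Finset.expect_product' univ univ fun ω _ => F ω]
  simp

/-- After `expect_mix`, `f` reads only one of two independent samples and `g` only the other. -/
theorem expect_mul_of_dependsOn {s t : Set ι} (hst : Disjoint s t) {f g : (ι → Bool) → ℝ}
    (hf : DependsOn f s) (hg : DependsOn g t) :
    𝔼 ω, f ω * g ω = (𝔼 ω, f ω) * 𝔼 ω, g ω := by
  classical
  rw [expect_mix s, Fintype.expect_mul_expect]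
  refine Finset.expect_congr rfl fun ω' _ => Finset.expect_congr rfl fun ω _ => ?_
  congr 1
  · exact hf fun i hi => by simp [hi]
  · exact hg fun i hi => by simp [Set.disjoint_right.1 hst hi]

theorem expect_prod_of_dependsOn {κ : Type*} (T : Finset κ) {s : κ → Set ι}
    (hs : (T : Set κ).PairwiseDisjoint s) {g : κ → (ι → Bool) → ℝ}
    (hg : ∀ k ∈ T, DependsOn (g k) (s k)) :
    𝔼 ω, ∏ k ∈ T, g k ω = ∏ k ∈ T, 𝔼 ω, g k ω := by
  classical
  induction T using Finset.induction_on with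
  | empty => simp
  | insert a T ha ih =>
    simp only [Finset.prod_insert ha]
    rw [expect_mul_of_dependsOn (s := s a) (t := ⋃ k ∈ T, s k), ih]
    · exact hs.subset (by simp)
    · exact fun k hk => hg k (Finset.mem_insert_of_mem hk)
    · rw [Set.disjoint_iUnion₂_right]
      intro k hk
      exact hs (by simp) (by simp [hk]) (by rintro rfl; exact ha hk)
    · exact hg a (Finset.mem_insert_self _ _)
    · intro x y hxy
      refine Finset.prod_congr rfl fun k hk => hg k (Finset.mem_insert_of_mem hk) fun i hi => ?_
      exact hxy i (Set.mem_biUnion hk hi)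

/-- A single bit is uniformly distributed. -/
theorem expect_apply_bit (i : ι) (f : Bool → ℝ) :
    𝔼 ω : ι → Bool, f (ω i) = (f true + f false) / 2 := by
  have h : 𝔼 ω : ι → Bool, f (ω i) = 𝔼 ω : ι → Bool, f (!ω i) := by
    let σ : (ι → Bool) ≃ (ι → Bool) :=
      { toFun := fun ω j => !ω j
        invFun := fun ω j => !ω j
        left_inv := fun ω => by ext; simp
        right_inv := fun ω => by ext; simp }
    exact Fintype.expect_equiv σ _ _ fun ω => by simp [σ]
  have h2 : (𝔼 ω : ι → Bool, f (ω i)) + 𝔼 ω : ι → Bool, f (!ω i) = f true + f false := by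
    rw [← Finset.expect_add_distrib, ← Fintype.expect_const (ι := ι → Bool) (f true + f false)]
    refine Finset.expect_congr rfl fun ω _ => ?_
    cases ω i <;> simp [add_comm]
  linarith

/-- Markov's inequality. -/
theorem expect_indicator_le {P : (ι → Bool) → Prop} [DecidablePred P] {W : (ι → Bool) → ℝ}
    {a : ℝ} (ha : 0 < a) (hW : ∀ ω, 0 ≤ W ω) (h : ∀ ω, P ω → a ≤ W ω) :
    𝔼 ω, (if P ω then (1 : ℝ) else 0) ≤ (𝔼 ω, W ω) / a := by
  rw [Finset.expect_div]
  refine Finset.expect_le_expect fun ω _ => ?_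
  split_ifs with hP
  · rw [one_le_div ha]; exact h ω hP
  · exact div_nonneg (hW ω) ha.le

end Average

/-! ### Reading a graph off its code -/

/-- The pairs `(u, v)` with `u < v < n`, in lexicographical order. -/
def edgePairs (n : ℕ) : List (ℕ × ℕ) :=
  (List.product (List.range n) (List.range n)).filter fun e => e.1 < e.2

/-- The bit of the code `x` that belongs to the pair of nodes `u, v`. -/
def adjBit (n : ℕ) (x : List Bool) (u v : ℕ) : Bool :=
  x.getD ((edgePairs n).findIdx fun e => decide (e = (min u v, max u v))) false

theorem primrec_edgePairs : Primrec edgePairs := by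
  unfold edgePairs List.product
  refine primrec_filter (Primrec.list_flatMap Primrec.list_range ?_) ?_
  · exact (Primrec.list_map (Primrec.list_range.comp Primrec.fst)
      (Primrec.pair (Primrec.snd.comp Primrec.fst) Primrec.snd).to₂).to₂
  · exact (Primrec.nat_lt.comp (Primrec.fst.comp Primrec.snd)
      (Primrec.snd.comp Primrec.snd)).decide.to₂

theorem primrec_adjBit {α : Type} [Primcodable α] {n u v : α → ℕ} {x : α → List Bool}
    (hn : Primrec n) (hx : Primrec x) (hu : Primrec u) (hv : Primrec v) :
    Primrec fun a => adjBit (n a) (x a) (u a) (v a) := by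
  refine (Primrec.list_getD false).comp hx
    (Primrec.list_findIdx (primrec_edgePairs.comp hn) ?_)
  exact (Primrec.eq.comp Primrec.snd (Primrec.pair
    (Primrec.nat_min.comp (hu.comp Primrec.fst) (hv.comp Primrec.fst))
    (Primrec.nat_max.comp (hu.comp Primrec.fst) (hv.comp Primrec.fst)))).decide.to₂

theorem map_edgeSlots (n : ℕ) :
    (edgeSlots n).map (Prod.map Fin.val Fin.val) = edgePairs n := by
  have h2 : List.product (List.range n) (List.range n)
      = (List.product (List.finRange n) (List.finRange n)).map (Prod.map Fin.val Fin.val) := by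
    have h : List.range n = (List.finRange n).map Fin.val := by simp
    simp only [List.product, h, List.map_flatMap, List.flatMap_map, List.map_map]
    rfl
  rw [edgePairs, h2, List.filter_map]
  rfl

theorem mem_edgeSlots {n : ℕ} {e : Fin n × Fin n} : e ∈ edgeSlots n ↔ e.1 < e.2 := by
  simp only [edgeSlots, List.mem_filter, decide_eq_true_eq, and_iff_right_iff_imp]
  exact fun _ => List.pair_mem_product.2 ⟨List.mem_finRange _, List.mem_finRange _⟩

theorem nodup_edgeSlots (n : ℕ) : (edgeSlots n).Nodup :=
  ((List.nodup_finRange n).product (List.nodup_finRange n)).filter _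

theorem length_edgePairs (n : ℕ) : (edgePairs n).length = (edgeSlots n).length := by
  rw [← map_edgeSlots, List.length_map]

/-- The slots, their transposes and the diagonal are disjoint in the `n × n` square. Only this
direction is needed to compare the code length with the randomness bound. -/
theorem length_edgeSlots_le (n : ℕ) : 2 * (edgeSlots n).length + n ≤ n * n := by
  classical
  let A : Finset (Fin n × Fin n) := (edgeSlots n).toFinset
  have hA : #A = (edgeSlots n).length := List.toFinset_card_of_nodup (nodup_edgeSlots n)
  have hAm : ∀ e, e ∈ A ↔ e.1 < e.2 := fun e => by simp [A, mem_edgeSlots]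
  have hd : Disjoint A (A.map (Equiv.prodComm _ _).toEmbedding) := by
    rw [Finset.disjoint_left]
    rintro ⟨a, b⟩ h1 h2
    simp only [Finset.mem_map_equiv, hAm] at h1 h2
    exact absurd h1 (not_lt.2 (le_of_lt h2))
  have hd2 : Disjoint (A ∪ A.map (Equiv.prodComm _ _).toEmbedding) (univ : Finset (Fin n)).diag := by
    rw [Finset.disjoint_left]
    rintro ⟨a, b⟩ h1 h2
    simp only [Finset.mem_union, Finset.mem_map_equiv, hAm, Finset.mem_diag] at h1 h2
    rcases h1 with h | h <;> simp [h2.2] at h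
  have := Finset.card_le_univ
    ((A ∪ A.map (Equiv.prodComm _ _).toEmbedding) ∪ (univ : Finset (Fin n)).diag)
  rw [Finset.card_union_of_disjoint hd2, Finset.card_union_of_disjoint hd, Finset.card_map] at this
  simp only [hA, Finset.diag_card, Finset.card_univ, Fintype.card_prod, Fintype.card_fin] at this
  omega

/-- The code of the graph whose edges are the pairs on which `ω` is true. -/
def bitsOf {n : ℕ} (ω : Sym2 (Fin n) → Bool) : List Bool :=
  (edgeSlots n).map fun e => ω s(e.1, e.2)

theorem length_bitsOf {n : ℕ} (ω : Sym2 (Fin n) → Bool) :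
    (bitsOf ω).length = (edgePairs n).length := by
  simp [bitsOf, length_edgePairs]

theorem adjBit_bitsOf {n : ℕ} (ω : Sym2 (Fin n) → Bool) {u v : Fin n} (h : u ≠ v) :
    adjBit n (bitsOf ω) u v = ω s(u, v) := by
  wlog huv : u < v generalizing u v
  · have := this h.symm (lt_of_le_of_ne (not_lt.1 huv) h.symm)
    rw [Sym2.eq_swap, ← this, adjBit, adjBit, min_comm, max_comm]
  have hmin : min (u : ℕ) v = u := min_eq_left (le_of_lt huv)
  have hmax : max (u : ℕ) v = v := max_eq_right (le_of_lt huv)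
  set p : ℕ × ℕ → Bool := fun e => decide (e = (min (u : ℕ) v, max (u : ℕ) v)) with hp
  have hi : (edgePairs n).findIdx p < (edgePairs n).length := by
    rw [List.findIdx_lt_length]
    refine ⟨((u : ℕ), (v : ℕ)), ?_, by simp [hp, hmin, hmax]⟩
    rw [← map_edgeSlots]
    exact List.mem_map.2 ⟨(u, v), mem_edgeSlots.2 huv, rfl⟩
  have hpi := List.findIdx_getElem (w := hi)
  have hi' : (edgePairs n).findIdx p < (edgeSlots n).length := by rwa [← length_edgePairs]
  have e1 : (edgePairs n)[(edgePairs n).findIdx p]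
      = Prod.map Fin.val Fin.val ((edgeSlots n)[(edgePairs n).findIdx p]) := by
    simp only [← map_edgeSlots, List.getElem_map]
  have e2 : (edgeSlots n)[(edgePairs n).findIdx p] = (u, v) := by
    have hpe : ∀ e, p e = true → e = ((u : ℕ), (v : ℕ)) := by simp [hp, hmin, hmax]
    have hpi := hpe _ hpi
    rw [e1, Prod.ext_iff] at hpi
    exact Prod.ext (Fin.ext hpi.1) (Fin.ext hpi.2)
  rw [adjBit, bitsOf, List.getD_eq_getElem _ _ (by simpa using hi'), List.getElem_map, e2]

/-- A diagonal pair is not listed, so the search runs off the end and the default `false` is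
returned. -/
theorem adjBit_self {n : ℕ} (ω : Sym2 (Fin n) → Bool) (u : ℕ) :
    adjBit n (bitsOf ω) u u = false := by
  rw [adjBit, List.getD_eq_default]
  rw [length_bitsOf]
  refine (List.findIdx_eq_length_of_false fun e he => ?_).ge
  have : e.1 < e.2 := by simpa using (List.mem_filter.1 he).2
  simp only [min_self, max_self, decide_eq_false_iff_not]
  rintro rfl
  exact lt_irrefl _ this

open Classical in
theorem graphCode_eq_bitsOf {n : ℕ} (G : SimpleGraph (Fin n)) :
    graphCode G = bitsOf fun e => decide (e ∈ G.edgeSet) := by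
  simp [graphCode, bitsOf]

open Classical in
theorem adjBit_graphCode {n : ℕ} (G : SimpleGraph (Fin n)) (u v : Fin n) :
    adjBit n (graphCode G) u v = decide (G.Adj u v) := by
  rw [graphCode_eq_bitsOf]
  rcases eq_or_ne u v with rfl | h
  · simp [adjBit_self]
  · simp [adjBit_bitsOf _ h]

/-! ### Random graphs pass every primitive recursive test -/

/-- Different positions of the code read different coordinates of `ω`, so its bits are independent
and fair. The diagonal coordinates of `ω` are never read. -/
theorem expect_bitsOf_eq {n : ℕ} {x : List Bool} (hx : x.length = (edgePairs n).length) :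
    𝔼 ω : Sym2 (Fin n) → Bool, (if bitsOf ω = x then (1 : ℝ) else 0)
      = (1 / 2) ^ (edgePairs n).length := by
  rw [length_edgePairs] at hx ⊢
  have h : ∀ ω : Sym2 (Fin n) → Bool, (if bitsOf ω = x then (1 : ℝ) else 0)
      = ∏ i : Fin (edgeSlots n).length,
        if ω s((edgeSlots n)[i].1, (edgeSlots n)[i].2) = x[i] then (1 : ℝ) else 0 := by
    intro ω
    rw [Finset.prod_ite_zero]
    simp only [Finset.mem_univ, forall_const, Finset.prod_const_one]
    congr 1
    rw [eq_iff_iff, List.ext_getElem_iff]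
    simp only [bitsOf, List.length_map, hx, true_and, List.getElem_map]
    exact ⟨fun h i => h i i.2 i.2, fun h i hi _ => h ⟨i, hi⟩⟩
  simp_rw [h]
  rw [expect_prod_of_dependsOn (s := fun i : Fin (edgeSlots n).length =>
    {s((edgeSlots n)[i].1, (edgeSlots n)[i].2)})]
  · have : ∀ i : Fin (edgeSlots n).length, 𝔼 ω : Sym2 (Fin n) → Bool,
        (if ω s((edgeSlots n)[i].1, (edgeSlots n)[i].2) = x[i] then (1 : ℝ) else 0) = 1 / 2 := by
      intro i
      rw [expect_apply_bit _ fun b => if b = x[i] then (1 : ℝ) else 0]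
      cases x[i] <;> simp
    rw [Finset.prod_congr rfl fun i _ => this i]
    simp
  · intro i _ j _ hij
    simp only [Function.onFun, Set.disjoint_singleton]
    intro he
    apply hij
    have hi := mem_edgeSlots.1 (List.getElem_mem (l := edgeSlots n) i.2)
    have hj := mem_edgeSlots.1 (List.getElem_mem (l := edgeSlots n) j.2)
    rw [Sym2.eq_iff] at he
    rcases he with ⟨h1, h2⟩ | ⟨h1, h2⟩
    · exact Fin.ext ((nodup_edgeSlots n).getElem_inj_iff.1 (Prod.ext h1 h2))
    · exact absurd hi (not_lt.2 (by
        have := hj.le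
        simp only [Fin.getElem_fin] at h1 h2
        rwa [← h1, ← h2] at this))
  · intro i _
    exact dependsOn_apply_bit _ fun b => if b = x[i] then (1 : ℝ) else 0

theorem length_filter_bitStrings (n : ℕ) (T : List Bool → Bool) :
    (((bitStrings (edgePairs n).length).filter T).length : ℝ) = 2 ^ (edgePairs n).length *
      𝔼 ω : Sym2 (Fin n) → Bool, (if T (bitsOf ω) = true then (1 : ℝ) else 0) := by
  classical
  set B := ((bitStrings (edgePairs n).length).filter T).toFinset with hB
  have hc : ((bitStrings (edgePairs n).length).filter T).length = #B :=
    (List.toFinset_card_of_nodup ((nodup_bitStrings _).filter _)).symm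
  have hBm : ∀ x, x ∈ B ↔ x.length = (edgePairs n).length ∧ T x = true := fun x => by
    simp [hB, mem_bitStrings]
  have h : ∀ ω : Sym2 (Fin n) → Bool, (if T (bitsOf ω) = true then (1 : ℝ) else 0)
      = ∑ x ∈ B, if bitsOf ω = x then (1 : ℝ) else 0 := by
    intro ω
    simp [hBm, length_bitsOf]
  simp_rw [h]
  rw [Finset.expect_sum_comm, hc,
    Finset.sum_congr rfl fun x hx => expect_bitsOf_eq ((hBm x).1 hx).1, Finset.sum_const,
    nsmul_eq_mul, mul_left_comm, ← mul_pow]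
  norm_num

/-- If the fraction of graphs on `n` nodes that fail a primitive recursive test is small
enough, then no `c log n`-random graph fails it. -/
theorem exists_forall_random_pass {c : ℝ} (hc : 0 ≤ c) {a : ℕ} (ha : c + 1 ≤ a)
    {T : ℕ → List Bool → Bool} (hT : Primrec₂ T) {N₀ : ℕ}
    (hP : ∀ n, N₀ ≤ n → 𝔼 ω : Sym2 (Fin n) → Bool,
      (if T n (bitsOf ω) = true then (1 : ℝ) else 0) ≤ (1 / 2) ^ (a * Nat.size n)) :
    ∃ N, ∀ n, N ≤ n → ∀ G : SimpleGraph (Fin n),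
      IsRandomGraph (fun m : ℕ => c * Real.logb 2 (m : ℝ)) G → T n (graphCode G) = false := by
  obtain ⟨i, hi⟩ := exists_complexity_le_of_test (len := fun n => (edgePairs n).length)
    (Primrec.list_length.comp primrec_edgePairs) hT
  refine ⟨max N₀ (2 ^ i), fun n hn G hG => ?_⟩
  rw [max_le_iff] at hn
  rw [← Bool.not_eq_true]
  intro hTG
  set M := (edgePairs n).length with hM
  set D := a * Nat.size n with hD
  have hlen : (graphCode G).length = M := by rw [graphCode_eq_bitsOf, length_bitsOf]
  set B := ((bitStrings M).filter (T n)).length with hB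
  have hpos : 1 ≤ B := List.length_pos_of_mem
    (List.mem_filter.2 ⟨mem_bitStrings.2 hlen, hTG⟩)
  have hcount : (B : ℝ) * 2 ^ D ≤ 2 ^ M := by
    rw [hB, length_filter_bitStrings n (T n), mul_assoc]
    refine mul_le_of_le_one_right (by positivity) ?_
    calc _ ≤ (1 / 2 : ℝ) ^ D * 2 ^ D := by gcongr; exact hP n hn.1
      _ = 1 := by rw [← mul_pow]; norm_num
  have hcount' : B * 2 ^ D ≤ 2 ^ M := by exact_mod_cast hcount
  -- The failing graph itself makes `B` positive, so the subtraction `M - D` is not truncated.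
  have hDM : D ≤ M := by
    have : 2 ^ D ≤ 2 ^ M := (Nat.le_mul_of_pos_left _ hpos).trans hcount'
    exact (Nat.pow_le_pow_iff_right (by norm_num)).1 this
  have hBk : B ≤ 2 ^ (M - D) := by
    refine Nat.le_of_mul_le_mul_right (hcount'.trans_eq ?_) (pow_pos (by norm_num : 0 < 2) D)
    rw [← pow_add, Nat.sub_add_cancel hDM]
  have hcx := hi n ⌊c * Real.logb 2 (n : ℝ)⌋₊ (M - D) (graphCode G) hlen hTG hBk
  have h1 : (complexity (graphCode G) (n, ⌊c * Real.logb 2 (n : ℝ)⌋₊) : ℝ) ≤ i + (M - D) := by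
    rw [← Nat.cast_sub hDM]; exact_mod_cast hcx
  have h2 : (M : ℝ) ≤ n * (n - 1) / 2 := by
    have := length_edgeSlots_le n
    rw [← length_edgePairs, ← hM] at this
    have : (2 * M + n : ℝ) ≤ n * n := by exact_mod_cast this
    linarith
  have h3 : (n : ℝ) * (n - 1) / 2 - c * Real.logb 2 n ≤ i + (M - D) := le_trans hG h1
  have hn0 : 0 < n := (pow_pos (by norm_num : 0 < 2) i).trans_le hn.2
  have h4 : Real.logb 2 n ≤ Nat.size n := by
    rw [Real.logb_le_iff_le_rpow (by norm_num) (by exact_mod_cast hn0), Real.rpow_natCast]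
    exact_mod_cast (Nat.lt_size_self n).le
  -- Of the `a ≥ c + 1` multiples of `size n` that are saved, `c` cover the allowed deficiency and
  -- one exceeds the decoder's constant `i`.
  have h5 : (i : ℝ) < Nat.size n := by exact_mod_cast Nat.lt_size.2 hn.2
  have h7 : (D : ℝ) = a * Nat.size n := by simp [hD]
  have h8 : (c + 1) * Nat.size n ≤ (a : ℝ) * Nat.size n := by gcongr
  have : c * Real.logb 2 n ≤ c * Nat.size n := by gcongr
  linarith

/-! ### Three tests: low degree, long routing table, missing short link -/

/-- The size is the least `k` with `n < 2 ^ k`, found by a search bounded by `n`; the power appears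
as the number of strings of length `k`. -/
theorem primrec_size : Primrec Nat.size := by
  refine (Primrec.list_findIdx (f := fun n => List.range (n + 1))
    (p := fun n k => decide (n < (bitStrings k).length))
    (Primrec.list_range.comp Primrec.succ) (Primrec.nat_lt.comp Primrec.fst
      (Primrec.list_length.comp (primrec_bitStrings.comp Primrec.snd))).decide.to₂).of_eq
    fun n => ?_
  have hlt : n.size < (List.range (n + 1)).length := by
    simp [Nat.size_le, Nat.lt_two_pow_self]
  rw [List.findIdx_eq hlt]
  simp only [List.getElem_range, length_bitStrings, decide_eq_true_eq, decide_eq_false_iff_not]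
  exact ⟨Nat.lt_size_self n, fun j hj => not_lt.2 (Nat.lt_size.1 hj)⟩

/-- The neighbours of the node `u` in the graph with code `x`. -/
def row (n : ℕ) (x : List Bool) (u : ℕ) : List ℕ := (List.range n).filter (adjBit n x u)

/-- The test whether the node `0` has at most about `n / 4` neighbours. -/
def lowDegree (n : ℕ) (x : List Bool) : Bool :=
  decide (3 * n ≤ 4 * ((List.range n).filter fun v => !adjBit n x 0 v).length)

/-- The index, among the neighbours of the node `0`, of the first neighbour of `w`. -/
def tableIndex (n : ℕ) (x : List Bool) (w : ℕ) : ℕ :=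
  bif decide (w = 0) || adjBit n x 0 w then 0 else (row n x 0).findIdx (adjBit n x w)

/-- The length of the routing table of the node `0`, in unary. -/
def tableLength (n : ℕ) (x : List Bool) : ℕ :=
  ((List.range n).map fun w => tableIndex n x w + 1).sum

/-- The test whether the routing table of the node `0` is longer than `3 n - K`. -/
def longTable (K n : ℕ) (x : List Bool) : Bool :=
  decide (3 * n < tableLength n x + K)

/-- The bound on the label of a common neighbour with the node `0`. -/
def linkBound (m n : ℕ) : ℕ := m * n.size + 2

/-- The test whether some node `u` has no common neighbour with the node `0` among the
first nodes. -/
def missingLink (m n : ℕ) (x : List Bool) : Bool :=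
  (List.range n).any fun u => !decide (u = 0) &&
    (List.range (linkBound m n)).all fun v => !(adjBit n x 0 v && adjBit n x u v)

theorem primrec_row {α : Type} [Primcodable α] {n u : α → ℕ} {x : α → List Bool}
    (hn : Primrec n) (hx : Primrec x) (hu : Primrec u) :
    Primrec fun a => row (n a) (x a) (u a) :=
  primrec_filter (Primrec.list_range.comp hn) (primrec_adjBit (hn.comp Primrec.fst)
    (hx.comp Primrec.fst) (hu.comp Primrec.fst) Primrec.snd).to₂

theorem primrec_lowDegree : Primrec₂ lowDegree := by
  change Primrec fun z : ℕ × List Bool => lowDegree z.1 z.2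
  refine (Primrec.nat_le.comp (Primrec.nat_mul.comp (Primrec.const 3) Primrec.fst)
    (Primrec.nat_mul.comp (Primrec.const 4) (Primrec.list_length.comp
      (primrec_filter (Primrec.list_range.comp Primrec.fst) ?_)))).decide
  exact (Primrec.not.comp (primrec_adjBit (Primrec.fst.comp Primrec.fst)
    (Primrec.snd.comp Primrec.fst) (Primrec.const 0) Primrec.snd)).to₂

theorem primrec_tableIndex {α : Type} [Primcodable α] {n w : α → ℕ} {x : α → List Bool}
    (hn : Primrec n) (hx : Primrec x) (hw : Primrec w) :
    Primrec fun a => tableIndex (n a) (x a) (w a) := by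
  refine Primrec.cond (Primrec.or.comp (Primrec.eq.comp hw (Primrec.const 0)).decide
    (primrec_adjBit hn hx (Primrec.const 0) hw)) (Primrec.const 0)
    (Primrec.list_findIdx (primrec_row hn hx (Primrec.const 0)) ?_)
  exact (primrec_adjBit (hn.comp Primrec.fst) (hx.comp Primrec.fst) (hw.comp Primrec.fst)
    Primrec.snd).to₂

theorem primrec_longTable (K : ℕ) : Primrec₂ (longTable K) := by
  change Primrec fun z : ℕ × List Bool => longTable K z.1 z.2
  refine (Primrec.nat_lt.comp (Primrec.nat_mul.comp (Primrec.const 3) Primrec.fst)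
    (Primrec.nat_add.comp (primrec_sum_map (Primrec.list_range.comp Primrec.fst) ?_)
      (Primrec.const K))).decide
  exact (Primrec.succ.comp (primrec_tableIndex (Primrec.fst.comp Primrec.fst)
    (Primrec.snd.comp Primrec.fst) Primrec.snd)).to₂

theorem primrec_missingLink (m : ℕ) : Primrec₂ (missingLink m) := by
  change Primrec fun z : ℕ × List Bool => missingLink m z.1 z.2
  refine primrec_any (Primrec.list_range.comp Primrec.fst) ?_
  have hn : Primrec fun z : (ℕ × List Bool) × ℕ => z.1.1 := Primrec.fst.comp Primrec.fst
  have hx : Primrec fun z : (ℕ × List Bool) × ℕ => z.1.2 := Primrec.snd.comp Primrec.fst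
  have hL : Primrec fun z : (ℕ × List Bool) × ℕ => linkBound m z.1.1 :=
    Primrec.nat_add.comp (Primrec.nat_mul.comp (Primrec.const m) (primrec_size.comp hn))
      (Primrec.const 2)
  have hp : Primrec fun z : ((ℕ × List Bool) × ℕ) × ℕ =>
      !(adjBit z.1.1.1 z.1.1.2 0 z.2 && adjBit z.1.1.1 z.1.1.2 z.1.2 z.2) :=
    Primrec.not.comp (Primrec.and.comp
      (primrec_adjBit (hn.comp Primrec.fst) (hx.comp Primrec.fst) (Primrec.const 0) Primrec.snd)
      (primrec_adjBit (hn.comp Primrec.fst) (hx.comp Primrec.fst)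
        (Primrec.snd.comp Primrec.fst) Primrec.snd))
  have h : Primrec fun z : (ℕ × List Bool) × ℕ => !decide (z.2 = 0) &&
      (List.range (linkBound m z.1.1)).all fun v =>
        !(adjBit z.1.1 z.1.2 0 v && adjBit z.1.1 z.1.2 z.2 v) :=
    Primrec.and.comp (Primrec.not.comp (Primrec.eq.comp Primrec.snd (Primrec.const 0)).decide)
      (primrec_all (Primrec.list_range.comp hL) hp.to₂)
  exact h.to₂

/-! ### Few graphs fail the tests -/

/-- Since `2 ^ size n ≤ 2 n`, the right side decays only polynomially. -/
theorem exists_forall_mul_pow_le {r : ℝ} (h0 : 0 ≤ r) (h1 : r < 1) {A : ℝ} (hA : 0 ≤ A) (a : ℕ) :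
    ∃ N : ℕ, ∀ n, N ≤ n → A * r ^ n ≤ (1 / 2) ^ (a * Nat.size n) := by
  have h := (tendsto_pow_const_mul_const_pow_of_lt_one a h0 h1).const_mul (A * 2 ^ a)
  rw [mul_zero] at h
  obtain ⟨N, hN⟩ := Filter.eventually_atTop.1 (h.eventually (eventually_le_nhds zero_lt_one))
  refine ⟨max N 1, fun n hn => ?_⟩
  rw [max_le_iff] at hn
  have hs : (2 : ℝ) ^ Nat.size n ≤ 2 * n := by
    have h2 : 0 < Nat.size n := Nat.size_pos.2 hn.2
    have : 2 ^ (Nat.size n - 1) ≤ n := Nat.lt_size.1 (by omega)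
    have h3 : 2 ^ Nat.size n ≤ 2 * n := by
      calc 2 ^ Nat.size n = 2 * 2 ^ (Nat.size n - 1) := by rw [← pow_succ']; congr 1; omega
        _ ≤ 2 * n := by omega
    exact_mod_cast h3
  have hs' : (2 : ℝ) ^ (a * Nat.size n) ≤ 2 ^ a * n ^ a := by
    rw [mul_comm, pow_mul, ← mul_pow]
    gcongr
  rw [one_div, inv_pow, ← one_div, le_div_iff₀ (by positivity)]
  calc A * r ^ n * 2 ^ (a * Nat.size n) ≤ A * r ^ n * (2 ^ a * n ^ a) := by gcongr
    _ = A * 2 ^ a * (n ^ a * r ^ n) := by ring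
    _ ≤ 1 := hN n hn.1

theorem findIdx_congr {α : Type*} {p q : α → Bool} {l : List α} (h : ∀ a ∈ l, p a = q a) :
    l.findIdx p = l.findIdx q := by
  induction l with
  | nil => rfl
  | cons a l ih =>
    rw [List.findIdx_cons, List.findIdx_cons, h a (by simp), ih fun b hb => h b (by simp [hb])]

theorem dependsOn_findIdx {ι : Type*} (l : List ι) :
    DependsOn (fun ω : ι → Bool => l.findIdx ω) {j | j ∈ l} :=
  fun _ _ h => findIdx_congr h

/-- The first bit either stops the search, with weight `4 / 3`, or multiplies the remaining weight
by `4 / 3`. The moment thus obeys `x ↦ 2 / 3 + (2 / 3) x`, whose fixed point is 2, starting from `4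
/ 3` for the empty list. -/
theorem expect_findIdx_le {ι : Type*} [Fintype ι] [DecidableEq ι] {l : List ι} (hl : l.Nodup) :
    𝔼 ω : ι → Bool, (4 / 3 : ℝ) ^ (l.findIdx ω + 1) ≤ 2 := by
  induction l with
  | nil => simp; norm_num
  | cons i l ih =>
    rw [List.nodup_cons] at hl
    have h : ∀ ω : ι → Bool, (4 / 3 : ℝ) ^ ((i :: l).findIdx ω + 1)
        = (bif ω i then 4 / 3 else 0)
          + (bif ω i then 0 else 4 / 3) * (4 / 3) ^ (l.findIdx ω + 1) := by
      intro ω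
      rw [List.findIdx_cons]
      cases ω i <;> simp [pow_succ']
    simp_rw [h]
    rw [Finset.expect_add_distrib, expect_mul_of_dependsOn (s := {i}) (t := {j | j ∈ l}),
      expect_apply_bit i fun b => bif b then (4 / 3 : ℝ) else 0,
      expect_apply_bit i fun b => bif b then (0 : ℝ) else 4 / 3]
    · have := ih hl.2
      simp only [cond_true, cond_false]
      linarith
    · simpa using hl.1
    · exact dependsOn_apply_bit i fun b => bif b then (0 : ℝ) else 4 / 3
    · exact fun x y h => by simp only [dependsOn_findIdx l h]

theorem length_filter_range (n : ℕ) (p : ℕ → Bool) :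
    ((List.range n).filter p).length = ∑ v : Fin n, if p v then 1 else 0 := by
  rw [← Finset.sum_range fun v => if p v then 1 else 0, ← Finset.card_filter,
    ← List.toFinset_card_of_nodup (List.nodup_range.filter p), List.toFinset_filter,
    List.toFinset_range]

theorem sum_map_range (n : ℕ) (f : ℕ → ℕ) : ((List.range n).map f).sum = ∑ v : Fin n, f v := by
  rw [← Finset.sum_range f]
  induction n with
  | zero => rfl
  | succ n ih => simp [List.range_succ, Finset.sum_range_succ, ih]

theorem row_eq_map {n : ℕ} {x : List Bool} {u : ℕ} {p : Fin n → Bool}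
    (h : ∀ v : Fin n, adjBit n x u v = p v) :
    row n x u = ((List.finRange n).filter p).map Fin.val := by
  have h2 : List.range n = (List.finRange n).map Fin.val := by simp
  rw [row, h2, List.filter_map]
  congr 2
  exact funext h

theorem expect_lowDegree_le {n : ℕ} (hn : 0 < n) :
    𝔼 ω : Sym2 (Fin n) → Bool, (if lowDegree n (bitsOf ω) = true then (1 : ℝ) else 0)
      ≤ 81 / 16 * (97 / 108) ^ n := by
  obtain ⟨k, rfl⟩ := Nat.exists_eq_add_one.2 hn
  -- A non-neighbour weighs `(3 / 2) ^ 4`, so failure forces weight at least `(3 / 2) ^ (3 n)`. Each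
  -- edge contributes the mean `97 / 32`, and `(97 / 32) / (27 / 8) = 97 / 108 < 1`. Node `0` always
  -- counts as its own non-neighbour, whence the factor `81 / 16`.
  let g : Fin (k + 1) → (Sym2 (Fin (k + 1)) → Bool) → ℝ := fun v ω =>
    bif decide (v = 0) then 81 / 16 else bif ω s(0, v) then 1 else 81 / 16
  have hg : ∀ ω, ∏ v, g v ω = (81 / 16) ^
      ((List.range (k + 1)).filter fun v => !adjBit (k + 1) (bitsOf ω) 0 v).length := by
    intro ω
    rw [length_filter_range, ← Finset.prod_pow_eq_pow_sum]
    refine Finset.prod_congr rfl fun v _ => ?_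
    rcases eq_or_ne v 0 with rfl | hv
    · simp [g, adjBit_self]
    · have := adjBit_bitsOf ω hv.symm
      rw [Fin.val_zero] at this
      rw [this]
      simp only [g, hv, decide_false, cond_false]
      cases ω s(0, v) <;> simp
  have hE : 𝔼 ω, ∏ v, g v ω = 81 / 16 * (97 / 32) ^ k := by
    rw [expect_prod_of_dependsOn (s := fun v => {s(0, v)}), Fin.prod_univ_succ]
    · have h0 : 𝔼 ω, g 0 ω = 81 / 16 := by simp [g]
      have h1 : ∀ v : Fin k, 𝔼 ω, g v.succ ω = 97 / 32 := by
        intro v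
        have := expect_apply_bit s(0, v.succ) fun b => bif b then (1 : ℝ) else 81 / 16
        simp only [g, Fin.succ_ne_zero, decide_false, cond_false, this, cond_true]
        norm_num
      simp only [h0, h1, Finset.prod_const, Finset.card_univ, Fintype.card_fin]
    · intro v _ w _ hvw
      simp only [Function.onFun, Set.disjoint_singleton, ne_eq, Sym2.eq_iff]
      rintro (⟨_, h⟩ | ⟨h, h'⟩)
      · exact hvw h
      · exact hvw (h'.trans h)
    · intro v _ x y h
      simp only [g, h s(0, v) rfl]
  refine (expect_indicator_le (W := fun ω => ∏ v, g v ω) (a := (27 / 8) ^ (k + 1))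
    (by positivity) (fun ω => by rw [hg]; positivity) fun ω h => ?_).trans ?_
  · rw [hg]
    have h := of_decide_eq_true h
    rw [show (27 / 8 : ℝ) = (3 / 2) ^ 3 by norm_num, show (81 / 16 : ℝ) = (3 / 2) ^ 4 by norm_num,
      ← pow_mul, ← pow_mul]
    exact pow_le_pow_right₀ (by norm_num) h
  · rw [hE, div_le_iff₀ (by positivity), mul_assoc, ← mul_pow]
    norm_num
    rw [pow_succ]
    have : (0 : ℝ) < (97 / 32) ^ k := by positivity
    linarith

/-- Each table entry has moment at most 2 in base `4 / 3`, while the allowance of 3 per entry weighs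
`(4 / 3) ^ 3 = 64 / 27 > 2`; the quotient is `27 / 32`. -/
theorem expect_longTable_le (K n : ℕ) (hn : 0 < n) :
    𝔼 ω : Sym2 (Fin n) → Bool, (if longTable K n (bitsOf ω) = true then (1 : ℝ) else 0)
      ≤ (4 / 3) ^ K * (27 / 32) ^ n := by
  have : NeZero n := ⟨hn.ne'⟩
  have hW : 𝔼 ω : Sym2 (Fin n) → Bool, (4 / 3 : ℝ) ^ tableLength n (bitsOf ω) ≤ 2 ^ n := by
    classical
    -- Condition on the edges at the hub: `ω'` fixes its neighbourhood `A`, and `ω` supplies all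
    -- other edges.
    rw [expect_mix {e | 0 ∈ e}, ← Fintype.expect_const (ι := Sym2 (Fin n) → Bool) ((2 : ℝ) ^ n)]
    refine Finset.expect_le_expect fun ω' _ => ?_
    set A := (List.finRange n).filter fun v => !decide (v = 0) && ω' s(0, v) with hA
    have hAm : ∀ v, v ∈ A ↔ v ≠ 0 ∧ ω' s(0, v) = true := by simp [hA]
    -- The pairs probed for `w` join a node outside `A` to a node of `A`, so different destinations
    -- probe disjoint sets of pairs and their entries are independent.
    let l : Fin n → List (Sym2 (Fin n)) := fun w =>
      if w = 0 ∨ w ∈ A then [] else A.map fun v => s(w, v)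
    have hl : ∀ ω, (4 / 3 : ℝ) ^ tableLength n (bitsOf (Set.piecewise {e | 0 ∈ e} ω' ω))
        = ∏ w, (4 / 3 : ℝ) ^ ((l w).findIdx ω + 1) := by
      intro ω
      set x := bitsOf (Set.piecewise {e | 0 ∈ e} ω' ω) with hx
      have hx0 : ∀ v : Fin n, v ≠ 0 → adjBit n x 0 v = ω' s(0, v) := by
        intro v hv
        have := adjBit_bitsOf (Set.piecewise {e | 0 ∈ e} ω' ω) hv.symm
        rwa [Set.piecewise_eq_of_mem _ _ _ (by simp), Fin.val_zero] at this
      have hx1 : ∀ w v : Fin n, w ≠ 0 → v ≠ 0 → w ≠ v → adjBit n x w v = ω s(w, v) := by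
        intro w v hw hv hwv
        rw [hx, adjBit_bitsOf _ hwv, Set.piecewise_eq_of_notMem _ _ _ (by simp [hw.symm, hv.symm])]
      have hrow : row n x 0 = A.map Fin.val := by
        refine row_eq_map fun v => ?_
        rcases eq_or_ne v 0 with rfl | hv
        · simp [hx, adjBit_self]
        · simp [hx0 v hv, hv]
      rw [tableLength, sum_map_range, ← Finset.prod_pow_eq_pow_sum]
      refine Finset.prod_congr rfl fun w _ => ?_
      congr 2
      by_cases hw0 : w = 0
      · simp [l, hw0, tableIndex]
      by_cases hwA : w ∈ A
      · have := ((hAm w).1 hwA).2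
        simp [l, hwA, tableIndex, hx0 w hw0, this]
      · have h0 : ω' s(0, w) = false := by
          simpa [hAm, hw0] using hwA
        have hw0' : (w : ℕ) ≠ 0 := by simpa using hw0
        simp only [tableIndex, hw0', hx0 w hw0, h0, decide_false, Bool.or_self, cond_false, l, hw0,
          hwA, or_self, if_false, hrow, List.findIdx_map]
        refine findIdx_congr fun v hv => ?_
        exact hx1 w v hw0 ((hAm v).1 hv).1 fun h => hwA (h ▸ hv)
    simp_rw [hl]
    rw [expect_prod_of_dependsOn (s := fun w => {e | e ∈ l w})]
    · refine (Finset.prod_le_prod (fun w _ => Finset.expect_nonneg fun ω _ => by positivity)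
        fun w _ => expect_findIdx_le (l := l w) ?_).trans (by simp)
      simp only [l]
      split_ifs
      · exact List.nodup_nil
      · refine List.Nodup.map (fun a b h => ?_) ((List.nodup_finRange n).filter _)
        rcases Sym2.eq_iff.1 h with ⟨_, h⟩ | ⟨h, h'⟩
        · exact h
        · exact h'.trans h
    · intro w _ w' _ hww
      rw [Function.onFun, Set.disjoint_left]
      simp only [Set.mem_ofPred_eq, l]
      split_ifs with h1 h2 h2
      · simp
      · simp
      · simp
      · simp only [List.mem_map]
        rintro _ ⟨v, hv, rfl⟩ ⟨v', hv', he⟩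
        rw [Sym2.eq_iff] at he
        rcases he with ⟨h, _⟩ | ⟨h, _⟩
        · exact hww h.symm
        · exact h2 (Or.inr (h ▸ hv))
    · intro w _ x y h
      simp only [dependsOn_findIdx (l w) h]
  refine (expect_indicator_le (W := fun ω => (4 / 3 : ℝ) ^ tableLength n (bitsOf ω))
    (a := (64 / 27) ^ n / (4 / 3) ^ K) (by positivity) (fun ω => by positivity)
    fun ω h => ?_).trans ?_
  · have h := of_decide_eq_true h
    rw [show (64 / 27 : ℝ) = (4 / 3) ^ 3 by norm_num, ← pow_mul, div_le_iff₀ (by positivity),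
      ← pow_add]
    exact pow_le_pow_right₀ (by norm_num) h.le
  · rw [div_le_iff₀ (by positivity)]
    refine hW.trans_eq ?_
    rw [mul_div_assoc', mul_assoc, ← mul_pow, mul_div_assoc, mul_div_cancel₀ _ (by positivity)]
    norm_num

theorem expect_missingLink_le (m n : ℕ) (hn : linkBound m n ≤ n) :
    𝔼 ω : Sym2 (Fin n) → Bool, (if missingLink m n (bitsOf ω) = true then (1 : ℝ) else 0)
      ≤ n * (3 / 4) ^ (m * Nat.size n) := by
  have hn0 : 0 < n := by unfold linkBound at hn; omega
  have : NeZero n := ⟨hn0.ne'⟩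
  -- Discarding the candidates `0` and `u` costs at most two nodes, which the `+ 2` in `linkBound`
  -- pays for.
  let V : Fin n → Finset (Fin n) := fun u =>
    ((univ.map (Fin.castLEEmb hn)).erase 0).erase u
  have hV : ∀ u, m * Nat.size n ≤ #(V u) := by
    intro u
    have h1 := Finset.pred_card_le_card_erase (s := (univ.map (Fin.castLEEmb hn)).erase 0) (a := u)
    have h2 := Finset.pred_card_le_card_erase (s := univ.map (Fin.castLEEmb hn)) (a := (0 : Fin n))
    simp only [Finset.card_map, Finset.card_univ, Fintype.card_fin] at h2
    have h3 : linkBound m n = m * Nat.size n + 2 := rfl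
    change _ ≤ #(((univ.map (Fin.castLEEmb hn)).erase 0).erase u)
    omega
  let g : Fin n → Fin n → (Sym2 (Fin n) → Bool) → ℝ := fun u v ω =>
    bif ω s(0, v) && ω s(u, v) then 0 else 1
  have hg0 : ∀ u v ω, 0 ≤ g u v ω := fun u v ω => by
    simp only [g]; cases ω s(0, v) && ω s(u, v) <;> simp
  have hE : ∀ u, u ≠ 0 → 𝔼 ω, ∏ v ∈ V u, g u v ω ≤ (3 / 4) ^ (m * Nat.size n) := by
    intro u hu
    -- Candidates outside `{0, u}` involve disjoint pairs of edges, so they fail independently, each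
    -- with probability `3 / 4`.
    rw [expect_prod_of_dependsOn (s := fun v => {s(0, v), s(u, v)})]
    · have : ∀ v, 𝔼 ω, g u v ω = 3 / 4 := by
        intro v
        have h1 : ∀ ω : Sym2 (Fin n) → Bool, g u v ω = 1 +
            (bif ω s(0, v) then -1 else 0) * (bif ω s(u, v) then 1 else 0) := by
          intro ω
          simp only [g]
          cases ω s(0, v) <;> cases ω s(u, v) <;> simp
        simp_rw [h1]
        rw [Finset.expect_add_distrib, expect_mul_of_dependsOn (s := {s(0, v)}) (t := {s(u, v)}),
          expect_apply_bit s(0, v) fun b => bif b then (-1 : ℝ) else 0,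
          expect_apply_bit s(u, v) fun b => bif b then (1 : ℝ) else 0]
        · simp
          norm_num
        · simp only [Set.disjoint_singleton, ne_eq, Sym2.eq_iff]
          rintro (⟨h, _⟩ | ⟨h, h'⟩)
          · exact hu h.symm
          · exact hu (h.trans h').symm
        · exact dependsOn_apply_bit s(0, v) fun b => bif b then (-1 : ℝ) else 0
        · exact dependsOn_apply_bit s(u, v) fun b => bif b then (1 : ℝ) else 0
      simp only [this, Finset.prod_const]
      exact pow_le_pow_of_le_one (by norm_num) (by norm_num) (hV u)
    · intro v hv w hw hvw
      simp only [V, Finset.coe_erase, Set.mem_sdiff, Set.mem_singleton_iff] at hv hw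
      rw [Function.onFun, Set.disjoint_left]
      rintro e he he'
      simp only [Set.mem_insert_iff, Set.mem_singleton_iff] at he he'
      rcases he with rfl | rfl <;> rcases he' with h | h <;> rw [Sym2.eq_iff] at h <;> tauto
    · intro v _ x y h
      simp only [g, h s(0, v) (by simp), h s(u, v) (by simp)]
  calc 𝔼 ω : Sym2 (Fin n) → Bool, (if missingLink m n (bitsOf ω) = true then (1 : ℝ) else 0)
      ≤ 𝔼 ω, ∑ u ∈ univ.erase 0, ∏ v ∈ V u, g u v ω := by
        refine Finset.expect_le_expect fun ω _ => ?_
        have hnn : ∀ u ∈ univ.erase (0 : Fin n), 0 ≤ ∏ v ∈ V u, g u v ω :=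
          fun u _ => Finset.prod_nonneg fun v _ => hg0 u v ω
        split_ifs with h
        · simp only [missingLink, List.any_eq_true, List.mem_range, Bool.and_eq_true,
            Bool.not_eq_true', decide_eq_false_iff_not, List.all_eq_true] at h
          obtain ⟨u, hun, hu0, h⟩ := h
          have hu : (⟨u, hun⟩ : Fin n) ≠ 0 := fun h0 => hu0 (by simpa using congrArg Fin.val h0)
          refine le_trans (le_of_eq ?_) (Finset.single_le_sum hnn
            (Finset.mem_erase.2 ⟨hu, Finset.mem_univ _⟩))
          refine (Finset.prod_eq_one fun v hv => ?_).symm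
          simp only [V, Finset.mem_erase, Finset.mem_map, Finset.mem_univ, true_and] at hv
          obtain ⟨hvu, hv0, i, rfl⟩ := hv
          have := h i i.2
          have e0 := adjBit_bitsOf ω hv0.symm
          have e1 := adjBit_bitsOf ω hvu.symm
          simp only [Fin.val_zero, Fin.coe_castLEEmb, Fin.val_castLE] at e0 e1
          rw [e0, e1] at this
          simp only [g, Fin.coe_castLEEmb, this, cond_false]
        · exact Finset.sum_nonneg hnn
    _ = ∑ u ∈ univ.erase 0, 𝔼 ω, ∏ v ∈ V u, g u v ω := Finset.expect_sum_comm _ _ _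
    _ ≤ ∑ u ∈ univ.erase (0 : Fin n), (3 / 4 : ℝ) ^ (m * Nat.size n) :=
        Finset.sum_le_sum fun u hu => hE u (Finset.ne_of_mem_erase hu)
    _ ≤ n * (3 / 4) ^ (m * Nat.size n) := by
        rw [Finset.sum_const, nsmul_eq_mul]
        gcongr
        exact (Finset.card_le_univ _).trans (by simp)

/-! ### Local routing programs -/

/-- Go to the destination `w` if it is a neighbour, and otherwise to the neighbour whose index
is stored in `p`. -/
def hubNext (z : List Bool × (ℕ × List ℕ × ℕ)) : ℕ :=
  bif z.2.2.1.any fun a => decide (a = z.2.2.2) then z.2.2.2 else z.2.2.1.getD (bitIndex z.1) 0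

/-- The string of blocks `1^j 0`, for the members `j` of a list. -/
def unaryTable (l : List ℕ) : List Bool := l.flatMap fun j => List.replicate j true ++ [false]

/-- The length of the `k`-th block of ones in a binary string. -/
def unaryBlock (k : ℕ) (q : List Bool) : ℕ :=
  (((fun s : List Bool => (s.dropWhile fun b => b).tail)^[k] q).takeWhile fun b => b).length

/-- Go to the destination `w` if it is a neighbour, and otherwise to the neighbour whose index
is stored in the block of `p` that belongs to `w`. -/
def tableNext (z : List Bool × (ℕ × List ℕ × ℕ)) : ℕ :=
  bif z.2.2.1.any fun a => decide (a = z.2.2.2) then z.2.2.2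
  else z.2.2.1.getD (unaryBlock (z.2.2.2 - 1) z.1) 0

theorem unaryBlock_unaryTable {l : List ℕ} {k : ℕ} (hk : k < l.length) :
    unaryBlock k (unaryTable l) = l[k] := by
  induction l generalizing k with
  | nil => simp at hk
  | cons j l ih =>
    have e : unaryTable (j :: l) = List.replicate j true ++ false :: unaryTable l := by
      simp [unaryTable]
    rw [e]
    cases k with
    | zero => simp [unaryBlock]
    | succ k =>
      have := ih (k := k) (by simpa using hk)
      rw [unaryBlock] at this ⊢
      rw [Function.iterate_succ_apply]
      simpa using this

theorem length_unaryTable (l : List ℕ) :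
    (unaryTable l).length = (l.map fun j => j + 1).sum := by
  simp [unaryTable, List.length_flatMap]

theorem primrec_any_eq : Primrec fun z : List Bool × (ℕ × List ℕ × ℕ) =>
    z.2.2.1.any fun a => decide (a = z.2.2.2) :=
  primrec_any (Primrec.fst.comp (Primrec.snd.comp Primrec.snd))
    (Primrec.eq.comp Primrec.snd (Primrec.snd.comp (Primrec.snd.comp
      (Primrec.snd.comp Primrec.fst)))).decide.to₂

theorem primrec_hubNext : Primrec hubNext :=
  Primrec.cond primrec_any_eq (Primrec.snd.comp (Primrec.snd.comp Primrec.snd))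
    ((Primrec.list_getD 0).comp (Primrec.fst.comp (Primrec.snd.comp Primrec.snd))
      (primrec_bitIndex.comp Primrec.fst))

theorem primrec_tableNext : Primrec tableNext := by
  have hw : Primrec fun z : List Bool × (ℕ × List ℕ × ℕ) => z.2.2.2 :=
    Primrec.snd.comp (Primrec.snd.comp Primrec.snd)
  have hd : Primrec fun s : List Bool => (s.dropWhile fun b => b).tail :=
    Primrec.list_tail.comp (Primrec.list_dropWhile Primrec.id)
  have hb : Primrec fun z : List Bool × (ℕ × List ℕ × ℕ) => unaryBlock (z.2.2.2 - 1) z.1 :=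
    Primrec.list_length.comp ((Primrec.list_takeWhile Primrec.id).comp
      (Primrec.nat_iterate (Primrec.pred.comp hw) Primrec.fst (hd.comp Primrec.snd).to₂))
  exact Primrec.cond primrec_any_eq hw
    ((Primrec.list_getD 0).comp (Primrec.fst.comp (Primrec.snd.comp Primrec.snd)) hb)

/-! ### The routing scheme -/

open Classical in
/-- The neighbours of `u` in increasing order. -/
noncomputable def nbrs {n : ℕ} (G : SimpleGraph (Fin n)) (u : Fin n) : List (Fin n) :=
  (List.finRange n).filter fun v => decide (G.Adj u v)

theorem mem_nbrs {n : ℕ} {G : SimpleGraph (Fin n)} {u v : Fin n} :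
    v ∈ nbrs G u ↔ G.Adj u v := by
  simp [nbrs]

theorem neighbourLabels_eq {n : ℕ} (G : SimpleGraph (Fin n)) (u : Fin n) :
    neighbourLabels G u = (nbrs G u).map label := rfl

theorem any_neighbourLabels {n : ℕ} {G : SimpleGraph (Fin n)} {u w : Fin n} :
    ((neighbourLabels G u).any fun a => decide (a = label w)) = true ↔ G.Adj u w := by
  simp [neighbourLabels_eq, label, mem_nbrs, Fin.val_inj]

theorem row_graphCode {n : ℕ} (G : SimpleGraph (Fin n)) (u : Fin n) :
    row n (graphCode G) u = (nbrs G u).map Fin.val :=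
  row_eq_map fun v => adjBit_graphCode G u v

/-- A strictly increasing list of naturals dominates its positions. Thus a neighbour with a small
label has a short index. -/
theorem le_getElem_nbrs {n : ℕ} {G : SimpleGraph (Fin n)} {u : Fin n} {i : ℕ}
    (hi : i < (nbrs G u).length) : i ≤ ((nbrs G u)[i] : ℕ) := by
  have hs : (nbrs G u).Pairwise (· < ·) := (List.pairwise_lt_finRange n).filter _
  induction i with
  | zero => exact Nat.zero_le _
  | succ i ih =>
    have h1 := ih (by omega)
    have h2 := List.pairwise_iff_getElem.1 hs i (i + 1) (by omega) hi (by omega)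
    rw [Fin.lt_def] at h2
    omega

theorem exists_index_nbrs {n : ℕ} {G : SimpleGraph (Fin n)} {u v : Fin n} (h : G.Adj u v) :
    ∃ i ≤ (v : ℕ), (neighbourLabels G u).getD i 0 = label v := by
  obtain ⟨i, hi, rfl⟩ := List.getElem_of_mem (mem_nbrs.2 h)
  refine ⟨i, le_getElem_nbrs hi, ?_⟩
  rw [neighbourLabels_eq, List.getD_eq_getElem _ _ (by simpa using hi), List.getElem_map]

theorem RoutingScheme.Route.reachable {n : ℕ} {G : SimpleGraph (Fin n)} {F : RoutingScheme G}
    {u w : Fin n} {k : ℕ} (h : F.Route w u k) : G.Reachable u w := by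
  induction h with
  | arrived => exact SimpleGraph.Reachable.refl _
  | hop h _ ih => exact (F.adj_next _ _ h).reachable.trans ih

/-- A scheme has stretch factor `2` if it delivers messages to neighbours in one hop and all
messages in at most four hops. -/
theorem stretchAtMost_two {n : ℕ} {G : SimpleGraph (Fin n)} {F : RoutingScheme G}
    (h1 : ∀ u w, G.Adj u w → F.next u w = w)
    (h4 : ∀ u w, u ≠ w → ¬ G.Adj u w → ∃ k ≤ 4, F.Route w u k) : F.StretchAtMost 2 := by
  intro u w huw
  by_cases hadj : G.Adj u w
  · refine ⟨1, .hop huw ((h1 u w hadj).symm ▸ .arrived), ?_⟩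
    rw [SimpleGraph.dist_eq_one_iff_adj.2 hadj]
    norm_num
  · obtain ⟨k, hk, hr⟩ := h4 u w huw hadj
    refine ⟨k, hr, ?_⟩
    have h0 : G.dist u w ≠ 0 := fun h => huw (hr.reachable.dist_eq_zero_iff.1 h)
    have h1 : G.dist u w ≠ 1 := fun h => hadj (SimpleGraph.dist_eq_one_iff_adj.1 h)
    have : k ≤ 2 * G.dist u w := by omega
    exact_mod_cast this

theorem exists_common_neighbour {m n : ℕ} [NeZero n] {G : SimpleGraph (Fin n)}
    (hL : linkBound m n ≤ n) (hlink : missingLink m n (graphCode G) = false) {u : Fin n}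
    (hu : u ≠ 0) : ∃ v : Fin n, (v : ℕ) < linkBound m n ∧ G.Adj 0 v ∧ G.Adj u v := by
  by_contra! hno
  rw [← Bool.not_eq_true] at hlink
  apply hlink
  simp only [missingLink, List.any_eq_true, List.mem_range, Bool.and_eq_true,
    Bool.not_eq_true', decide_eq_false_iff_not, List.all_eq_true]
  refine ⟨u, u.2, by simpa using hu, fun v hv => ?_⟩
  have h0 := adjBit_graphCode G 0 ⟨v, hv.trans_le hL⟩
  have h1 := adjBit_graphCode G u ⟨v, hv.trans_le hL⟩
  have := hno ⟨v, hv.trans_le hL⟩ hv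
  simp only [Fin.val_zero] at h0
  rw [h0, h1]
  simpa using this

theorem exists_tableIndex_nbrs {n : ℕ} [NeZero n] {G : SimpleGraph (Fin n)} {w : Fin n}
    (hw : w ≠ 0) (h0 : ¬ G.Adj 0 w) (h : ∃ v, G.Adj 0 v ∧ G.Adj w v) :
    ∃ v, G.Adj 0 v ∧ G.Adj w v ∧
      (neighbourLabels G 0).getD (tableIndex n (graphCode G) w) 0 = label v := by
  classical
  have hrow := row_graphCode G 0
  have hadj := adjBit_graphCode G 0 w
  rw [Fin.val_zero] at hrow hadj
  have hw' : (w : ℕ) ≠ 0 := by simpa using hw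
  have hidx : tableIndex n (graphCode G) w = (nbrs G 0).findIdx fun v => decide (G.Adj w v) := by
    simp only [tableIndex, hw', hadj, h0, decide_false, Bool.or_self, cond_false, hrow,
      List.findIdx_map]
    exact findIdx_congr fun v _ => adjBit_graphCode G w v
  have hlt : (nbrs G 0).findIdx (fun v => decide (G.Adj w v)) < (nbrs G 0).length := by
    obtain ⟨v, hv0, hv⟩ := h
    exact List.findIdx_lt_length.2 ⟨v, mem_nbrs.2 hv0, by simpa using hv⟩
  refine ⟨(nbrs G 0)[(nbrs G 0).findIdx fun v => decide (G.Adj w v)],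
    mem_nbrs.1 (List.getElem_mem hlt), by simpa using List.findIdx_getElem (w := hlt), ?_⟩
  rw [hidx, neighbourLabels_eq, List.getD_eq_getElem _ _ (by simpa using hlt), List.getElem_map]

open Classical in
theorem exists_routingScheme {m n i₁ i₂ : ℕ} [NeZero n] {G : SimpleGraph (Fin n)}
    (hi₁ : ∀ p y, Computes (program i₁ p) y (hubNext (p, y)))
    (hi₂ : ∀ p y, Computes (program i₂ p) y (tableNext (p, y)))
    (hL : linkBound m n ≤ n) (hlink : missingLink m n (graphCode G) = false) :
    ∃ (F : RoutingScheme G) (store : Fin n → List Bool), F.StretchAtMost 2 ∧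
      (∀ v, F.StoredBy v (store v)) ∧
      (store 0).length = i₂ + 1 + tableLength n (graphCode G) ∧
      ∀ v, v ≠ 0 → (store v).length =
        i₁ + 1 + if G.Adj 0 v then 0 else (linkBound m n).size := by
  have hcommon := fun u (hu : u ≠ 0) => exists_common_neighbour hL hlink hu
  -- A neighbour of the hub stores no index bits: the hub has the least label, so it stands first in
  -- the list and the empty string names it.
  have hhub : ∀ u : Fin n, u ≠ 0 → ∃ v i, G.Adj u v ∧ (G.Adj 0 u → v = 0) ∧
      (¬ G.Adj 0 u → G.Adj 0 v) ∧ (neighbourLabels G u).getD i 0 = label v ∧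
      i < 2 ^ (if G.Adj 0 u then 0 else (linkBound m n).size) := by
    intro u hu
    by_cases h : G.Adj 0 u
    · obtain ⟨i, hi, hiv⟩ := exists_index_nbrs h.symm
      exact ⟨0, i, h.symm, fun _ => rfl, fun h' => absurd h h', hiv, by simpa [h] using hi⟩
    · obtain ⟨v, hv, hv0, huv⟩ := hcommon u hu
      obtain ⟨i, hi, hiv⟩ := exists_index_nbrs huv
      refine ⟨v, i, huv, fun h' => absurd h' h, fun _ => hv0, hiv, ?_⟩
      rw [if_neg h]
      exact (hi.trans_lt hv).trans (Nat.lt_size_self _)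
  choose! hub idx hub_adj hub_zero hub_link hub_idx idx_lt using hhub
  choose! q hq hqi using fun u hu => exists_bitIndex_eq (idx_lt u hu)
  have htab : ∀ w : Fin n, w ≠ 0 → ¬ G.Adj 0 w → ∃ v, G.Adj 0 v ∧ G.Adj w v ∧
      (neighbourLabels G 0).getD (tableIndex n (graphCode G) w) 0 = label v := fun w hw h =>
    exists_tableIndex_nbrs hw h ((hcommon w hw).imp fun _ h => h.2)
  choose! t t_adj t_link t_idx using htab
  let next : Fin n → Fin n → Fin n := fun u w =>
    if G.Adj u w then w else if u = 0 then t w else hub u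
  have next_adj : ∀ u w, G.Adj u w → next u w = w := fun u w h => if_pos h
  have next_zero : ∀ w, ¬ G.Adj 0 w → next 0 w = t w := fun w h => by simp [next, h]
  have next_hub : ∀ u w, u ≠ 0 → ¬ G.Adj u w → next u w = hub u := fun u w hu h => by
    simp [next, h, hu]
  let F : RoutingScheme G :=
    { next := next
      adj_next := fun u w huw => by
        by_cases h : G.Adj u w
        · rwa [next_adj u w h]
        · rcases eq_or_ne u 0 with rfl | hu
          · rw [next_zero w h]
            exact t_adj w huw.symm h
          · rw [next_hub u w hu h]
            exact hub_adj u hu }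
  let table := unaryTable ((List.range n).map (tableIndex n (graphCode G)))
  refine ⟨F, fun u => if u = 0 then program i₂ table else program i₁ (q u), ?_, ?_, ?_, ?_⟩
  · have hroute : ∀ u w k, u ≠ w → F.Route w (next u w) k → F.Route w u (k + 1) :=
      fun u w k h hr => .hop h hr
    have route_adj : ∀ u w, G.Adj u w → F.Route w u 1 := fun u w h =>
      hroute u w 0 h.ne ((next_adj u w h).symm ▸ .arrived)
    have route_zero : ∀ w, ∃ k ≤ 2, F.Route w 0 k := by
      intro w
      by_cases hw : w = 0
      · exact ⟨0, by norm_num, hw ▸ .arrived⟩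
      by_cases h : G.Adj 0 w
      · exact ⟨1, by norm_num, route_adj 0 w h⟩
      · refine ⟨2, le_rfl, hroute 0 w 1 (Ne.symm hw) ?_⟩
        rw [next_zero w h]
        exact route_adj _ _ (t_link w hw h).symm
    have route_near : ∀ u w, G.Adj 0 u → ∃ k ≤ 3, F.Route w u k := by
      intro u w h0
      by_cases hw : u = w
      · exact ⟨0, by norm_num, hw ▸ .arrived⟩
      by_cases h : G.Adj u w
      · exact ⟨1, by norm_num, route_adj u w h⟩
      · obtain ⟨k, hk, hr⟩ := route_zero w
        refine ⟨k + 1, by omega, hroute u w k hw ?_⟩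
        rwa [next_hub u w h0.ne' h, hub_zero u h0.ne' h0]
    refine stretchAtMost_two next_adj fun u w huw h => ?_
    rcases eq_or_ne u 0 with rfl | hu
    · obtain ⟨k, hk, hr⟩ := route_zero w
      exact ⟨k, by omega, hr⟩
    by_cases h0 : G.Adj 0 u
    · obtain ⟨k, hk, hr⟩ := route_near u w h0
      exact ⟨k, by omega, hr⟩
    -- The longest route goes from `u` to its link, to the hub, to the hub's table entry and to `w`.
    -- A link adjacent to `w` delivers at once.
    · obtain ⟨k, hk, hr⟩ := route_near (hub u) w (hub_link u hu h0)
      refine ⟨k + 1, by omega, hroute u w k huw ?_⟩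
      rwa [next_hub u w hu h]
  · intro u w hwu
    change Computes (if u = 0 then program i₂ table else program i₁ (q u)) _ (label (next u w))
    rcases eq_or_ne u 0 with rfl | hu
    · rw [if_pos rfl]
      convert hi₂ table (label (0 : Fin n), neighbourLabels G 0, label w) using 1
      by_cases h : G.Adj 0 w
      · simp only [tableNext, any_neighbourLabels.2 h, cond_true, next_adj 0 w h]
      · have h' := (not_congr (any_neighbourLabels (G := G) (u := 0) (w := w))).2 h
        rw [Bool.not_eq_true] at h'
        simp only [tableNext, h', cond_false, next_zero w h, ← t_idx w hwu h]
        congr 1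
        -- Labels start at 1 and table blocks at 0, hence the subtraction in `tableNext`.
        simp only [label, Nat.add_sub_cancel, table]
        rw [unaryBlock_unaryTable (by simp)]
        simp
    · rw [if_neg hu]
      convert hi₁ (q u) (label u, neighbourLabels G u, label w) using 1
      by_cases h : G.Adj u w
      · simp only [hubNext, any_neighbourLabels.2 h, cond_true, next_adj u w h]
      · have h' := (not_congr (any_neighbourLabels (G := G) (u := u) (w := w))).2 h
        rw [Bool.not_eq_true] at h'
        simp only [hubNext, h', cond_false, next_hub u w hu h, ← hub_idx u hu, hqi u hu]
  · simp [table, length_unaryTable, tableLength, Function.comp_def]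
  · intro v hv
    simp only [hv, if_false, length_program, hq v hv]

/-! ### Asymptotic bounds -/

theorem size_le_logb_add_one {n : ℕ} (hn : 0 < n) :
    (Nat.size n : ℝ) ≤ Real.logb 2 n + 1 := by
  have hs : 0 < Nat.size n := Nat.size_pos.2 hn
  have h : 2 ^ (Nat.size n - 1) ≤ n := Nat.lt_size.1 (by omega)
  have h2 : ((Nat.size n - 1 : ℕ) : ℝ) ≤ Real.logb 2 n := by
    rw [Real.le_logb_iff_rpow_le (by norm_num) (by exact_mod_cast hn), Real.rpow_natCast]
    exact_mod_cast h
  rw [Nat.cast_sub hs, Nat.cast_one] at h2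
  linarith

theorem size_le_two_mul_logb {n : ℕ} (hn : 2 ≤ n) : (Nat.size n : ℝ) ≤ 2 * Real.logb 2 n := by
  have h := size_le_logb_add_one (n := n) (by omega)
  have : 1 ≤ Real.logb 2 (n : ℝ) := by
    rw [Real.le_logb_iff_rpow_le (by norm_num) (by positivity), Real.rpow_one]
    exact_mod_cast hn
  linarith

theorem exists_forall_linkBound_le (m : ℕ) : ∃ N, ∀ n, N ≤ n → linkBound m n ≤ n := by
  -- The constant makes `m * size n ≤ n / 2`; the remaining summand 2 is at most `n / 2` once `n ≥
  -- 4`.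
  have h := (Real.isLittleO_log_id_atTop.comp_tendsto tendsto_natCast_atTop_atTop).def
    (c := Real.log 2 / (4 * (m + 1))) (by have := Real.log_pos one_lt_two; positivity)
  obtain ⟨N, hN⟩ := Filter.eventually_atTop.1 h
  refine ⟨max N 4, fun n hn => ?_⟩
  rw [max_le_iff] at hn
  have h1 := hN n hn.1
  have hl : 0 < Real.log 2 := Real.log_pos one_lt_two
  have h2 : Real.log n ≤ Real.log 2 / (4 * (m + 1)) * n := by
    simpa using (le_abs_self _).trans h1
  have h3 : Real.logb 2 n ≤ n / (4 * (m + 1)) := by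
    rw [Real.logb, div_le_iff₀ hl]
    exact h2.trans_eq (by ring)
  have h4 := size_le_two_mul_logb (n := n) (by omega)
  have h5 : (m : ℝ) * Nat.size n ≤ n / 2 := by
    calc (m : ℝ) * Nat.size n ≤ (m + 1) * (2 * (n / (4 * (m + 1)))) := by
          gcongr
          · linarith
          · linarith
      _ = n / 2 := by field_simp; ring
  have h6 : (4 : ℝ) ≤ n := by exact_mod_cast hn.2
  have : (linkBound m n : ℝ) ≤ n := by
    simp only [linkBound, Nat.cast_add, Nat.cast_mul, Nat.cast_ofNat]
    linarith
  exact_mod_cast this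

theorem size_linkBound_le (m : ℕ) {n : ℕ} (hn : 2 ≤ n) :
    (Nat.size (linkBound m n) : ℝ) ≤
      Real.logb 2 (Real.logb 2 n) + (Real.logb 2 (2 * (m + 2)) + 1) := by
  have hs := size_le_two_mul_logb hn
  have hs1 : (1 : ℝ) ≤ Nat.size n := by exact_mod_cast Nat.size_pos.2 (by omega : 0 < n)
  have hlog : 0 < Real.logb 2 (n : ℝ) := by linarith
  have hL : (linkBound m n : ℝ) ≤ Real.logb 2 n * (2 * (m + 2)) := by
    simp only [linkBound, Nat.cast_add, Nat.cast_mul, Nat.cast_ofNat]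
    calc (m : ℝ) * Nat.size n + 2 ≤ (m + 2) * Nat.size n := by linarith
      _ ≤ (m + 2) * (2 * Real.logb 2 n) := by gcongr
      _ = _ := by ring
  have hpos : 0 < linkBound m n := by simp [linkBound]
  refine (size_le_logb_add_one hpos).trans ?_
  have := Real.logb_le_logb_of_le (b := 2) (by norm_num) (by exact_mod_cast hpos) hL
  rw [Real.logb_mul hlog.ne' (by positivity)] at this
  linarith

theorem exists_forall_le_logb_logb (A : ℝ) :
    ∃ N : ℕ, ∀ n : ℕ, N ≤ n → A ≤ Real.logb 2 (Real.logb 2 n) :=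
  Filter.eventually_atTop.1 (((Real.tendsto_logb_atTop one_lt_two).comp
    ((Real.tendsto_logb_atTop one_lt_two).comp tendsto_natCast_atTop_atTop)).eventually_ge_atTop A)

/-- Because `(3 / 4) ^ 3 < 1 / 2`, the factor 3 turns the base into `1 / 2`, and the extra 1 in `a +
1` pays for the union bound over `n` nodes. -/
theorem mul_three_quarters_pow_le (a n : ℕ) :
    (n : ℝ) * (3 / 4) ^ (3 * (a + 1) * Nat.size n) ≤ (1 / 2) ^ (a * Nat.size n) := by
  have h1 : (n : ℝ) ≤ 2 ^ Nat.size n := by exact_mod_cast (Nat.lt_size_self n).le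
  calc (n : ℝ) * (3 / 4) ^ (3 * (a + 1) * Nat.size n)
      = n * (27 / 64) ^ (a * Nat.size n + Nat.size n) := by
        rw [mul_assoc, pow_mul]; norm_num [add_mul]
    _ ≤ 2 ^ Nat.size n * (1 / 2) ^ (a * Nat.size n + Nat.size n) :=
        mul_le_mul h1 (pow_le_pow_left₀ (by norm_num) (by norm_num) _) (by positivity)
          (by positivity)
    _ = (1 / 2) ^ (a * Nat.size n) := by
        rw [pow_add, mul_left_comm, ← mul_pow]; norm_num

end CompactRouting

/-! ### Choice of constants and the total bit count -/

theorem mainTheorem11 (c : ℝ) (hc : 0 ≤ c) :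
    ∃ (C : ℝ) (N : ℕ), ∀ n : ℕ, N ≤ n → ∀ G : SimpleGraph (Fin n),
      CompactRouting.IsRandomGraph (fun m : ℕ => c * Real.logb 2 (m : ℝ)) G →
      ∃ (F : CompactRouting.RoutingScheme G) (store : Fin n → List Bool) (r : Fin n),
        F.StretchAtMost 2 ∧
        (∀ v, F.StoredBy v (store v)) ∧
        (∀ v, v ≠ r →
          ((store v).length : ℝ) ≤ Real.logb 2 (Real.logb 2 (n : ℝ)) + C) ∧
        (store r).length ≤ 3 * n ∧
        ((∑ v, (store v).length : ℕ) : ℝ) ≤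
          (n : ℝ) * Real.logb 2 (Real.logb 2 (n : ℝ)) + 3 * (n : ℝ) := by
  classical
  open CompactRouting in
  obtain ⟨i₁, hi₁⟩ := exists_program_computes primrec_hubNext.to_comp
  obtain ⟨i₂, hi₂⟩ := exists_program_computes primrec_tableNext.to_comp
  set a := ⌈c⌉₊ + 1 with ha
  have hca : c + 1 ≤ a := by
    have := Nat.le_ceil c
    rw [ha]
    push_cast
    linarith
  set m := 3 * (a + 1) with hm
  -- `K` is the length of the prefix of the hub's program, so passing `longTable K` bounds the whole
  -- program by `3 n`.
  set K := i₂ + 1 with hK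
  obtain ⟨A₁, hA₁⟩ := exists_forall_mul_pow_le (r := 97 / 108) (by norm_num) (by norm_num)
    (A := 81 / 16) (by norm_num) a
  obtain ⟨A₂, hA₂⟩ := exists_forall_mul_pow_le (r := 27 / 32) (by norm_num) (by norm_num)
    (A := (4 / 3) ^ K) (by positivity) a
  obtain ⟨A₃, hA₃⟩ := exists_forall_linkBound_le m
  obtain ⟨N₁, hN₁⟩ := exists_forall_random_pass hc hca primrec_lowDegree (N₀ := max A₁ 1)
    fun n hn => (expect_lowDegree_le (by omega)).trans (hA₁ n (by omega))
  obtain ⟨N₂, hN₂⟩ := exists_forall_random_pass hc hca (primrec_longTable K) (N₀ := max A₂ 1)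
    fun n hn => (expect_longTable_le K n (by omega)).trans (hA₂ n (by omega))
  obtain ⟨N₃, hN₃⟩ := exists_forall_random_pass hc hca (primrec_missingLink m) (N₀ := A₃)
    fun n hn => (expect_missingLink_le m n (hA₃ n hn)).trans (mul_three_quarters_pow_le a n)
  set C' := Real.logb 2 (2 * (m + 2)) + 1 with hC'
  have hC'0 : 0 ≤ C' := by
    have : 0 ≤ Real.logb 2 (2 * ((m : ℝ) + 2)) :=
      Real.logb_nonneg (by norm_num) (by have : (0 : ℝ) ≤ m := by positivity
                                         linarith)
    linarith
  -- This threshold is what makes `(i₁ + 1) + (3 / 4) (ll + C') ≤ ll`, the average cost per node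
  -- besides the hub's table.
  obtain ⟨N₄, hN₄⟩ := exists_forall_le_logb_logb (4 * (i₁ + 1) + 3 * C')
  refine ⟨i₁ + 1 + C', N₁ + N₂ + N₃ + N₄ + A₃ + 2, fun n hn G hG => ?_⟩
  have : NeZero n := ⟨by omega⟩
  have hdeg := hN₁ n (by omega) G hG
  have htab := hN₂ n (by omega) G hG
  have hlink := hN₃ n (by omega) G hG
  have hll := hN₄ n (by omega)
  have hsize := size_linkBound_le m (n := n) (by omega)
  obtain ⟨F, store, hF, hstore, h0, hlen⟩ :=
    exists_routingScheme hi₁ hi₂ (hA₃ n (by omega)) hlink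
  set ll := Real.logb 2 (Real.logb 2 (n : ℝ)) with hl
  set k := (linkBound m n).size with hk
  have hr : (store 0).length ≤ 3 * n := by
    have := of_decide_eq_false htab
    omega
  refine ⟨F, store, 0, hF, hstore, fun v hv => ?_, hr, ?_⟩
  · have : (store v).length ≤ i₁ + 1 + k := by
      rw [hlen v hv]
      split_ifs <;> omega
    have : ((store v).length : ℝ) ≤ i₁ + 1 + k := by exact_mod_cast this
    linarith
  -- Only the non-neighbours of the hub store an index. Bounding all `n` nodes by `log log n + C`
  -- would leave a term `C n` that does not fit the total.
  · set M := ∑ v : Fin n, if G.Adj 0 v then 0 else 1 with hM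
    have hM4 : 4 * M < 3 * n := by
      have := of_decide_eq_false hdeg
      rw [length_filter_range, not_le] at this
      refine lt_of_eq_of_lt (congrArg _ (Finset.sum_congr rfl fun v _ => ?_)) this
      have hv := adjBit_graphCode G 0 v
      rw [Fin.val_zero] at hv
      rw [hv]
      by_cases h : G.Adj 0 v <;> simp [h]
    have hsum : ∑ v, (store v).length ≤ 3 * n + (n * (i₁ + 1) + M * k) := by
      calc ∑ v, (store v).length
          ≤ ∑ v : Fin n, ((if v = 0 then 3 * n else 0)
              + ((i₁ + 1) + (if G.Adj 0 v then 0 else 1) * k)) := by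
            refine Finset.sum_le_sum fun v _ => ?_
            rcases eq_or_ne v 0 with rfl | hv
            · rw [if_pos rfl]
              omega
            · rw [if_neg hv, hlen v hv]
              split_ifs <;> simp
        _ = _ := by
            rw [Finset.sum_add_distrib, Finset.sum_add_distrib, ← Finset.sum_mul, ← hM]
            simp
    have hsum' : ((∑ v, (store v).length : ℕ) : ℝ) ≤ 3 * n + (n * (i₁ + 1) + M * k) := by
      exact_mod_cast hsum
    have hM' : (M : ℝ) ≤ 3 / 4 * n := by
      have : (4 * M : ℝ) ≤ 3 * n := by exact_mod_cast hM4.le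
      linarith
    have hMk : (M : ℝ) * k ≤ 3 / 4 * n * (ll + C') := by gcongr
    have : (n : ℝ) * (4 * (i₁ + 1) + 3 * C') ≤ n * ll := by gcongr
    linarith
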